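/- Let $p$ be a prime and let $G$ be a finite $p$-group of order $p^n$, $n \ge 2$, of maximal class, i.e. of nilpotence class $n-1$; assume that $G$ is not cyclic (this is automatic if $n \ge 3$ and only excludes the cyclic group of order $p^2$) and that $G$ is metabelian, i.e. its derived subgroup $G'$ is abelian. For an irreducible complex character $\chi$ of $G$ define its codegree as $\operatorname{cod}(\chi) = |G : \ker\chi|/\chi(1)$, and let $\operatorname{cod}(G)$ be the set of the codegrees of all irreducible complex characters of $G$. Then $$\operatorname{cod}(G) = \{p^i \mid 0 \le i \le c\} \quad\text{where } c = n-1 \text{ or } c = n-2.$$ -/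

import Mathlib

/-- The codegree `|G : ker χ| / χ(1)` of the character `χ` afforded by a finite-dimensional complex
representation `ρ` of `G`: the kernel of `χ` is the kernel of `ρ`, and `χ(1)` is the dimension. -/
noncomputable def codegree {G : Type*} [Group G] {V : Type*} [AddCommGroup V] [Module ℂ V]
    (ρ : Representation ℂ G V) : ℚ :=
  ((MonoidHom.ker ρ).index : ℚ) / (Module.finrank ℂ V : ℚ)

/-- The set `cod(G)` of codegrees of the irreducible complex characters of `G`. -/
def cod (G : Type*) [Group G] : Set ℚ :=
  {q | ∃ (V : Type) (_ : AddCommGroup V) (_ : Module ℂ V) (_ : FiniteDimensional ℂ V)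
      (ρ : Representation ℂ G V), ρ.IsIrreducible ∧ q = codegree ρ}

/-- `G` is metabelian: its derived subgroup is abelian, that is, `G'' = 1`. -/
def IsMetabelian (G : Type*) [Group G] : Prop :=
  derivedSeries G 2 = ⊥

/-- `G` is a `p`-group of order `p ^ n`, `n ≥ 2`, of maximal class, i.e. of nilpotence class
`n - 1`. -/
structure IsMaximalClass (p n : ℕ) (G : Type*) [Group G] : Prop where
  two_le : 2 ≤ n
  card_eq : Nat.card G = p ^ n
  class_eq : Group.nilpotencyClass G = n - 1

/-! Irreducible degrees divide the group order, so every codegree is a power `p ^ i` with `i ≤ n`;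
the value `i = n` would need a faithful linear character, making `G` cyclic. This is
`exists_eq_pow_of_mem_cod`.

Existence of the lower powers is an induction through `G ⧸ Z(G)`, again of maximal class because
`|Z(G)| = p` for `n ≥ 3`; codegrees of a quotient are codegrees of `G`. A faithful irreducible
character exists, of degree `p ^ b`: `b ≠ 0` since `G` is not cyclic, and `b ≤ 2` since `G'` is
abelian of index dividing `p ^ 2`. If `b = 2`, its codegree is the power `p ^ (n - 2)` that the
quotient may lack. If `b = 1`, faithfulness yields an abelian subgroup of index dividing `p`; its
image in `G ⧸ Z(G)` forces the top power `p ^ (n - 2)` there. Hence `IsMaximalClass.pow_mem_cod`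
proves two statements together. The constant `c` then records whether `p ^ (n - 1)` occurs. -/

open Module
open scoped commutatorElement

namespace Representation

/-! ### Irreducibility via invariant subspaces -/

section Irreducible

variable {k G V : Type*} [Field k] [Group G] [AddCommGroup V] [Module k V]
  {ρ : Representation k G V}

theorem IsIrreducible.nontrivial_space (h : ρ.IsIrreducible) : Nontrivial V := by
  by_contra hV
  rw [not_nontrivial_iff_subsingleton] at hV
  have := h.toNontrivial
  obtain ⟨a, b, hab⟩ := exists_pair_ne (Subrepresentation ρ)
  exact hab (Subrepresentation.toSubmodule_injective (Subsingleton.elim _ _))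

theorem IsIrreducible.eq_bot_or_eq_top_of_invariant (h : ρ.IsIrreducible) (W : Submodule k V)
    (hW : ∀ g, ∀ v ∈ W, ρ g v ∈ W) : W = ⊥ ∨ W = ⊤ := by
  rcases h.eq_bot_or_eq_top ⟨W, fun g v hv => hW g v hv⟩ with h | h
  · exact Or.inl (congrArg Subrepresentation.toSubmodule h)
  · exact Or.inr (congrArg Subrepresentation.toSubmodule h)

theorem isIrreducible_of_invariant [Nontrivial V]
    (h : ∀ W : Submodule k V, (∀ g, ∀ v ∈ W, ρ g v ∈ W) → W = ⊥ ∨ W = ⊤) : ρ.IsIrreducible where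
  exists_pair_ne := ⟨⊥, ⊤, fun e =>
    bot_ne_top (α := Submodule k V) (congrArg Subrepresentation.toSubmodule e)⟩
  eq_bot_or_eq_top W := by
    rcases h W.toSubmodule (fun g v hv => W.apply_mem_toSubmodule g hv) with h | h
    · exact Or.inl (Subrepresentation.toSubmodule_injective h)
    · exact Or.inr (Subrepresentation.toSubmodule_injective h)

theorem IsIrreducible.comp_iff {H : Type*} [Group H] {f : H →* G} (hf : Function.Surjective f) :
    IsIrreducible (ρ.comp f) ↔ ρ.IsIrreducible := by
  constructor <;> intro h <;> have := h.nontrivial_space <;>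
    refine isIrreducible_of_invariant fun W hW => h.eq_bot_or_eq_top_of_invariant W ?_
  · exact fun g v hv => hW (f g) v hv
  · intro g v hv
    obtain ⟨x, rfl⟩ := hf g
    exact hW x v hv

theorem isIrreducible_of_finrank_eq_one (h : finrank k V = 1) : ρ.IsIrreducible := by
  have : IsSimpleOrder (Submodule k V) := by
    have := isSimpleModule_iff_finrank_eq_one.2 h
    exact (isSimpleModule_iff k V).1 this
  have : Nontrivial V := nontrivial_of_finrank_eq_succ h
  exact isIrreducible_of_invariant fun W _ => eq_bot_or_eq_top W

end Irreducible

/-! ### Degrees of irreducible representations -/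

section Degree

variable {G : Type*} [Group G] {V : Type*} [AddCommGroup V] [Module ℂ V] [FiniteDimensional ℂ V]
  {ρ : Representation ℂ G V}

/-- An element commuting with an irreducible representation acts by a scalar. -/
theorem IsIrreducible.exists_smul_of_commute (h : ρ.IsIrreducible) (f : V →ₗ[ℂ] V)
    (hf : ∀ g, Commute f (ρ g)) : ∃ c : ℂ, ∀ v, f v = c • v := by
  have := h.nontrivial_space
  obtain ⟨c, hc⟩ := Module.End.exists_eigenvalue f
  refine ⟨c, fun v => ?_⟩
  have h1 := (h.eq_bot_or_eq_top_of_invariant (Module.End.eigenspace f c) ?_).resolve_left hc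
  · exact Module.End.mem_eigenspace_iff.1 (h1 ▸ Submodule.mem_top)
  · intro g v hv
    rw [Module.End.mem_eigenspace_iff] at hv ⊢
    have := LinearMap.congr_fun (hf g).eq v
    simp only [Module.End.mul_apply] at this
    rw [this, hv, map_smul]

/-- The values of a character of a finite group are algebraic integers. -/
theorem isIntegral_character [Finite G] (ρ : Representation ℂ G V) (g : G) :
    IsIntegral ℤ (ρ.character g) := by
  rw [Representation.character, Module.End.trace_eq_sum_roots_charpoly_of_splits
    (IsAlgClosed.splits _)]
  refine Subalgebra.multiset_sum_mem (S := integralClosure ℤ ℂ) (m := _) fun c hc => ?_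
  have hc := (Module.End.hasEigenvalue_iff_isRoot_charpoly _ _).2
    (Polynomial.isRoot_of_mem_roots hc)
  obtain ⟨v, hv⟩ := hc.exists_hasEigenvector
  have h1 : c ^ orderOf g = 1 := by
    have h2 := hv.pow_apply (orderOf g)
    rw [← map_pow, pow_orderOf_eq_one, map_one, Module.End.one_apply] at h2
    exact (smul_left_injective ℂ hv.2 (by simpa using h2)).symm
  exact IsIntegral.of_pow (orderOf_pos g) (h1 ▸ isIntegral_one)

/-- The degree of an irreducible complex representation divides the order of the group. -/
theorem IsIrreducible.finrank_dvd_card [Finite G] (h : ρ.IsIrreducible) :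
    finrank ℂ V ∣ Nat.card G := by
  classical
  have := h.nontrivial_space
  have := Fintype.ofFinite G
  have hGne : (Nat.card G : ℂ) ≠ 0 := by exact_mod_cast Nat.card_pos.ne'
  let R := integralClosure ℤ ℂ
  let χ : G → R := fun g => ⟨ρ.character g, isIntegral_character ρ g⟩
  -- The element `∑ χ(g⁻¹) g` is integral, since `R[G]` is finite over `R`, and it acts by a scalar
  -- `c`. Taking traces and using orthonormality of characters gives `c * χ(1) = |G|`, so `|G| /
  -- χ(1)` is a rational algebraic integer.
  let u : MonoidAlgebra R G := ∑ g, MonoidAlgebra.single g (χ g⁻¹)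
  let Φ : MonoidAlgebra R G →ₐ[R] (V →ₗ[ℂ] V) := MonoidAlgebra.lift R (V →ₗ[ℂ] V) G ρ
  have hΦ : Φ u = ∑ g, ρ.character g⁻¹ • ρ g := by
    simp only [u, Φ, map_sum, MonoidAlgebra.lift_single]
    rfl
  obtain ⟨c, hc⟩ := h.exists_smul_of_commute (Φ u) (fun x => by
    rw [hΦ, commute_iff_eq, Finset.sum_mul, Finset.mul_sum]
    refine Fintype.sum_equiv (MulAut.conj x⁻¹).toEquiv _ _ fun g => ?_
    simp only [MulEquiv.toEquiv_eq_coe, EquivLike.coe_coe, MulAut.conj_apply, inv_inv, mul_inv_rev]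
    have h1 : x⁻¹ * (g⁻¹ * x) = x⁻¹ * g⁻¹ * (x⁻¹)⁻¹ := by group
    rw [h1, ρ.char_conj, smul_mul_assoc, mul_smul_comm, ← map_mul, ← map_mul]
    congr 2
    group)
  have hcint : IsIntegral ℤ c := by
    have h1 : IsIntegral R u := IsIntegral.of_finite R u
    have h2 : IsIntegral R (algebraMap ℂ (V →ₗ[ℂ] V) c) := by
      have : algebraMap ℂ (V →ₗ[ℂ] V) c = Φ u := by
        ext v; rw [hc]; rfl
      rw [this]
      exact h1.map Φ
    have h3 : IsIntegral R c := by
      rwa [isIntegral_algebraMap_iff (FaithfulSMul.algebraMap_injective ℂ (V →ₗ[ℂ] V))] at h2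
    exact isIntegral_trans (R := ℤ) (A := R) c h3
  have hmul : c * finrank ℂ V = Nat.card G := by
    have h1 : LinearMap.trace ℂ V (Φ u) = c * finrank ℂ V := by
      have : Φ u = c • (1 : V →ₗ[ℂ] V) := by ext v; rw [hc]; rfl
      rw [this, map_smul, LinearMap.trace_one, smul_eq_mul]
    have : Invertible (Nat.card G : ℂ) := invertibleOfNonzero hGne
    have h2 := ρ.char_orthonormal ρ
    rw [if_pos ⟨Representation.Equiv.refl ρ⟩, inv_mul_eq_iff_eq_mul₀ hGne, mul_one] at h2
    rw [← h1, hΦ, map_sum, ← h2]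
    refine Finset.sum_congr rfl fun g _ => ?_
    rw [map_smul, smul_eq_mul, mul_comm]
    rfl
  have hd : (finrank ℂ V : ℂ) ≠ 0 := by exact_mod_cast (finrank_pos (R := ℂ) (M := V)).ne'
  have hc' : algebraMap ℚ ℂ ((Nat.card G : ℚ) / finrank ℂ V) = c := by
    rw [map_div₀, map_natCast, map_natCast, ← hmul, mul_div_cancel_right₀ _ hd]
  rw [← hc', isIntegral_algebraMap_iff (algebraMap ℚ ℂ).injective,
    IsIntegrallyClosed.isIntegral_iff] at hcint
  obtain ⟨m, hm⟩ := hcint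
  rw [eq_div_iff (by exact_mod_cast hd)] at hm
  have : (m * finrank ℂ V : ℤ) = Nat.card G := by
    simp only [eq_intCast] at hm
    exact_mod_cast hm
  exact Int.natCast_dvd_natCast.1 ⟨m, by rw [← this, mul_comm]⟩

theorem IsIrreducible.finrank_dvd_index_ker [Finite G] (h : ρ.IsIrreducible) :
    finrank ℂ V ∣ (MonoidHom.ker ρ).index := by
  let σ : Representation ℂ (G ⧸ MonoidHom.ker ρ) V :=
    QuotientGroup.lift (MonoidHom.ker ρ) ρ (fun _ hx => hx)
  have h1 : σ.comp (QuotientGroup.mk' (MonoidHom.ker ρ)) = ρ := by ext; rfl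
  have h2 : σ.IsIrreducible :=
    (IsIrreducible.comp_iff (QuotientGroup.mk'_surjective _)).1 (by rwa [h1])
  exact h2.finrank_dvd_card

/-- In a minimal nonzero invariant subspace, an eigenspace of any one operator is again invariant by
commutativity, hence is everything. -/
theorem exists_common_eigenvector {A : Type*} [Group A] [IsMulCommutative A] [Nontrivial V]
    (σ : Representation ℂ A V) : ∃ v : V, v ≠ 0 ∧ ∀ a, ∃ c : ℂ, σ a v = c • v := by
  obtain ⟨W, ⟨hW0, hW⟩, hmin⟩ := wellFounded_lt.has_min
    {W : Submodule ℂ V | W ≠ ⊥ ∧ ∀ a, ∀ v ∈ W, σ a v ∈ W} ⟨⊤, top_ne_bot, fun _ _ _ => Submodule.mem_top⟩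
  obtain ⟨v, hvW, hv⟩ := W.exists_mem_ne_zero_of_ne_bot hW0
  refine ⟨v, hv, fun a => ?_⟩
  have : Nontrivial W := ⟨⟨v, hvW⟩, 0, fun e => hv (congrArg Subtype.val e)⟩
  obtain ⟨c, hc⟩ := Module.End.exists_eigenvalue ((σ a).restrict (hW a))
  obtain ⟨w, hw⟩ := hc.exists_hasEigenvector
  have hw1 : σ a w = c • (w : V) := congrArg Subtype.val hw.apply_eq_smul
  refine ⟨c, ?_⟩
  by_contra hvc
  refine hmin (W ⊓ Module.End.eigenspace (σ a) c) ⟨?_, ?_⟩ (lt_of_le_of_ne inf_le_left ?_)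
  · refine (Submodule.ne_bot_iff _).2 ⟨w, ⟨w.2, Module.End.mem_eigenspace_iff.2 hw1⟩, ?_⟩
    exact fun e => hw.2 (Subtype.ext e)
  · rintro b x ⟨hx, hxc⟩
    refine ⟨hW b x hx, ?_⟩
    have hxc := Module.End.mem_eigenspace_iff.1 hxc
    refine Module.End.mem_eigenspace_iff.2 ?_
    rw [← Module.End.mul_apply, ← map_mul, mul_comm', map_mul, Module.End.mul_apply, hxc, map_smul]
  · intro e
    exact hvc (Module.End.mem_eigenspace_iff.1 (inf_eq_left.1 e hvW))

/-- The degree of an irreducible representation is at most the index of an abelian subgroup. -/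
theorem IsIrreducible.finrank_le_index [Finite G] (h : ρ.IsIrreducible) (A : Subgroup G)
    [IsMulCommutative A] : finrank ℂ V ≤ A.index := by
  have := h.nontrivial_space
  obtain ⟨v, hv, hA⟩ := exists_common_eigenvector (ρ.comp A.subtype)
  replace hA : ∀ a ∈ A, ∃ c : ℂ, ρ a v = c • v := fun a ha => hA ⟨a, ha⟩
  -- Elements of `A` only rescale `v`, so up to scalars the orbit of `v` has one vector per left
  -- coset of `A`; its span is invariant and nonzero.
  have hspan : Submodule.span ℂ (Set.range fun q : G ⧸ A => ρ q.out v) = ⊤ := by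
    refine (h.eq_bot_or_eq_top_of_invariant _ ?_).resolve_left ?_
    · have key : ∀ g, ρ g v ∈ Submodule.span ℂ (Set.range fun q : G ⧸ A => ρ q.out v) := by
        intro g
        obtain ⟨a, ha⟩ := QuotientGroup.mk_out_eq_mul A g
        obtain ⟨c, hc⟩ := hA _ (A.inv_mem a.2)
        have : ρ g v = c • ρ (g : G ⧸ A).out v := by
          rw [← map_smul, ← hc, ha, ← Module.End.mul_apply, ← map_mul, mul_inv_cancel_right]
        rw [this]
        exact Submodule.smul_mem _ _ (Submodule.subset_span ⟨_, rfl⟩)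
      intro g w hw
      induction hw using Submodule.span_induction with
      | mem x hx =>
        obtain ⟨q, rfl⟩ := hx
        simp only [← Module.End.mul_apply, ← map_mul]
        exact key _
      | zero => simp
      | add x y _ _ hx hy => rw [map_add]; exact Submodule.add_mem _ hx hy
      | smul c x _ hx => rw [map_smul]; exact Submodule.smul_mem _ _ hx
    · intro e
      rw [Submodule.span_eq_bot] at e
      have h0 := e _ ⟨((1 : G) : G ⧸ A), rfl⟩
      apply hv
      have : ρ ((1 : G) : G ⧸ A).out⁻¹ (ρ ((1 : G) : G ⧸ A).out v) = 0 := by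
        rw [show ρ ((1 : G) : G ⧸ A).out v = 0 from h0, map_zero]
      rwa [← Module.End.mul_apply, ← map_mul, inv_mul_cancel, map_one, Module.End.one_apply] at this
  have := Fintype.ofFinite (G ⧸ A)
  calc finrank ℂ V = finrank ℂ (Submodule.span ℂ (Set.range fun q : G ⧸ A => ρ q.out v)) := by
        rw [hspan, finrank_top]
    _ ≤ Fintype.card (G ⧸ A) := finrank_range_le_card _
    _ = A.index := by rw [Fintype.card_eq_nat_card]; rfl

/-- A group with a faithful representation of degree one is cyclic. -/
theorem isCyclic_of_finrank_eq_one [Finite G] (hρ : Function.Injective ρ)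
    (h : finrank ℂ V = 1) : IsCyclic G := by
  refine isCyclic_of_injective_ringHom (R := ℂ) (LinearMap.det.comp ρ) ?_
  intro x y hxy
  apply hρ
  obtain ⟨c, hc, -⟩ := LinearMap.existsUnique_eq_smul_id_of_finrank_eq_one h (ρ x)
  obtain ⟨d, hd, -⟩ := LinearMap.existsUnique_eq_smul_id_of_finrank_eq_one h (ρ y)
  have hcd : c = d := by simpa [hc, hd, h] using hxy
  rw [hc, hd, hcd]

end Degree

/-! ### Existence of irreducible representations -/

section Existence

/-- The nonidentity elements of a finite group are detected by its irreducible representations. -/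
theorem exists_isIrreducible_of_apply_ne_one {G : Type*} [Group G] [Finite G] {z : G} :
    ∀ (k : ℕ) (V : Type) [AddCommGroup V] [Module ℂ V] [FiniteDimensional ℂ V]
      (ρ : Representation ℂ G V), finrank ℂ V = k → ρ z ≠ 1 →
    ∃ (V : Type) (_ : AddCommGroup V) (_ : Module ℂ V) (_ : FiniteDimensional ℂ V)
      (ρ : Representation ℂ G V), ρ.IsIrreducible ∧ ρ z ≠ 1 := by
  intro k
  induction k using Nat.strong_induction_on with
  | _ k ih =>
    intro V _ _ _ ρ hk hz
    by_cases hρ : ρ.IsIrreducible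
    · exact ⟨V, _, _, inferInstance, ρ, hρ, hz⟩
    have : Nontrivial V := by
      by_contra hV
      rw [not_nontrivial_iff_subsingleton] at hV
      exact hz (LinearMap.ext fun v => Subsingleton.elim _ _)
    obtain ⟨W, hW0, hW1⟩ : ∃ W : Subrepresentation ρ, W ≠ ⊥ ∧ W ≠ ⊤ := by
      by_contra! hcon
      refine hρ (isIrreducible_of_invariant fun W hW => ?_)
      by_cases h0 : W = ⊥
      · exact Or.inl h0
      · exact Or.inr (congrArg Subrepresentation.toSubmodule (hcon ⟨W, fun g v hv => hW g v hv⟩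
          (fun e => h0 (congrArg Subrepresentation.toSubmodule e))))
    -- Maschke: if `z` fixed both summands pointwise, it would act trivially on `V`.
    obtain ⟨W', hWW'⟩ := exists_isCompl W
    have step : ∀ U : Subrepresentation ρ, U ≠ ⊤ → (∃ u ∈ U.toSubmodule, ρ z u ≠ u) →
        ∃ (V : Type) (_ : AddCommGroup V) (_ : Module ℂ V) (_ : FiniteDimensional ℂ V)
          (ρ : Representation ℂ G V), ρ.IsIrreducible ∧ ρ z ≠ 1 := by
      rintro U hU ⟨u, hu, hzu⟩
      refine ih _ ?_ U.toSubmodule U.toRepresentation rfl ?_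
      · rw [← hk]
        exact Submodule.finrank_lt fun e => hU (Subrepresentation.toSubmodule_injective e)
      · intro e
        exact hzu (congrArg Subtype.val (LinearMap.congr_fun e ⟨u, hu⟩))
    by_cases hu : ∃ u ∈ W.toSubmodule, ρ z u ≠ u
    · exact step W hW1 hu
    by_cases hu' : ∃ u ∈ W'.toSubmodule, ρ z u ≠ u
    · refine step W' (fun e => hW0 ?_) hu'
      rw [e] at hWW'
      exact eq_bot_of_isCompl_top hWW'
    push Not at hu hu'
    exfalso
    apply hz
    ext v
    have hv : v ∈ W.toSubmodule ⊔ W'.toSubmodule := by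
      rw [← Subrepresentation.toSubmodule_sup, hWW'.sup_eq_top]
      exact Submodule.mem_top
    obtain ⟨a, ha, b, hb, rfl⟩ := Submodule.mem_sup.1 hv
    rw [map_add, hu a ha, hu' b hb, Module.End.one_apply]

theorem exists_isIrreducible_apply_ne_one {G : Type*} [Group G] [Finite G] {z : G} (hz : z ≠ 1) :
    ∃ (V : Type) (_ : AddCommGroup V) (_ : Module ℂ V) (_ : FiniteDimensional ℂ V)
      (ρ : Representation ℂ G V), ρ.IsIrreducible ∧ ρ z ≠ 1 := by
  classical
  obtain ⟨e⟩ : Nonempty (G ≃ Fin (Nat.card G)) := ⟨Finite.equivFin G⟩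
  -- The regular representation, transported to `Fin` so that the space lies in `Type`.
  let ρ : Representation ℂ G (Fin (Nat.card G) → ℂ) :=
    { toFun := fun g => LinearMap.funLeft ℂ ℂ fun i => e (g⁻¹ * e.symm i)
      map_one' := by ext; simp [LinearMap.funLeft]
      map_mul' := fun x y => by
        apply LinearMap.ext
        intro f
        funext i
        simp [LinearMap.funLeft, mul_assoc] }
  refine exists_isIrreducible_of_apply_ne_one _ _ ρ rfl fun h => hz ?_
  have h1 := congrFun (LinearMap.congr_fun h (Pi.single (e 1) 1)) (e z)
  by_contra hz'
  simp [ρ, LinearMap.funLeft, hz'] at h1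

end Existence

end Representation

/-- Endomorphisms commuting with an endomorphism that has distinct eigenvalues commute. -/
theorem Module.Basis.commute_of_commute_of_injective_eigenvalues {K V ι : Type*} [Field K]
    [AddCommGroup V] [Module K V] (b : Basis ι K V) {f s t : End K V} {μ : ι → K}
    (hμ : Function.Injective μ) (hf : ∀ i, f (b i) = μ i • b i) (hs : Commute f s)
    (ht : Commute f t) : Commute s t := by
  have hrepr : ∀ w j, b.repr (f w) j = μ j * b.repr w j := by
    intro w j
    have : (b.coord j).comp f = μ j • b.coord j := by
      refine b.ext fun i => ?_
      by_cases h : i = j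
      · subst h; simp [hf]
      · simp [hf, Finsupp.single_eq_of_ne' h]
    exact LinearMap.congr_fun this w
  have hdiag : ∀ u : End K V, Commute f u → ∀ i, u (b i) = b.repr (u (b i)) i • b i := by
    intro u hu i
    refine b.ext_elem fun j => ?_
    by_cases h : i = j
    · subst h; simp
    · have h1 := hrepr (u (b i)) j
      have h2 : f (u (b i)) = μ i • u (b i) := by
        have := LinearMap.congr_fun hu.eq (b i)
        simpa [Module.End.mul_apply, hf] using this
      have h3 : (μ i - μ j) * b.repr (u (b i)) j = 0 := by
        rw [sub_mul, ← h1, h2]; simp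
      have h4 := (mul_eq_zero.1 h3).resolve_left (sub_ne_zero.2 fun e => h (hμ e))
      simp [h4, Finsupp.single_eq_of_ne' h]
  refine b.ext fun i => ?_
  obtain ⟨c, hc⟩ : ∃ c : K, s (b i) = c • b i := ⟨_, hdiag s hs i⟩
  obtain ⟨d, hd⟩ : ∃ d : K, t (b i) = d • b i := ⟨_, hdiag t ht i⟩
  rw [Module.End.mul_apply, Module.End.mul_apply, hc, hd, map_smul, map_smul, hc, hd, smul_comm]

/-! ### Commutators with an element of the second center -/

section CommutatorHom

variable {G : Type*} [Group G]

/-- The homomorphism `g ↦ g a g⁻¹ a⁻¹` into the center, for `a` in the second center. -/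
def commutatorHomOfSecondCenter (a : G) (ha : ∀ g, g * a * g⁻¹ * a⁻¹ ∈ Subgroup.center G) :
    G →* Subgroup.center G where
  toFun g := ⟨g * a * g⁻¹ * a⁻¹, ha g⟩
  map_one' := by ext; simp
  map_mul' x y := by
    ext
    have h := Subgroup.mem_center_iff.1 (ha y) x
    calc x * y * a * (x * y)⁻¹ * a⁻¹ = x * (y * a * y⁻¹ * a⁻¹) * (a * x⁻¹ * a⁻¹) := by group
      _ = (y * a * y⁻¹ * a⁻¹) * x * (a * x⁻¹ * a⁻¹) := by rw [h]
      _ = (y * a * y⁻¹ * a⁻¹) * (x * a * x⁻¹ * a⁻¹) := by group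
      _ = (x * a * x⁻¹ * a⁻¹) * (y * a * y⁻¹ * a⁻¹) :=
        (Subgroup.mem_center_iff.1 (ha y) _).symm

theorem mem_ker_commutatorHomOfSecondCenter {a : G}
    {ha : ∀ g, g * a * g⁻¹ * a⁻¹ ∈ Subgroup.center G} {g : G} :
    g ∈ (commutatorHomOfSecondCenter a ha).ker ↔ g * a = a * g := by
  rw [MonoidHom.mem_ker, Subtype.ext_iff]
  change g * a * g⁻¹ * a⁻¹ = 1 ↔ _
  rw [mul_inv_eq_one, mul_inv_eq_iff_eq_mul]

end CommutatorHom

/-- A nilpotent group with center of prime order `p` and a faithful irreducible representation of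
degree `p` has an abelian subgroup of index dividing `p`. -/
theorem Representation.IsIrreducible.exists_isMulCommutative_index_dvd {G : Type*} [Group G]
    [Group.IsNilpotent G] {p : ℕ} (hp : p.Prime) (hZ : Nat.card (Subgroup.center G) = p)
    {V : Type*} [AddCommGroup V] [Module ℂ V] [FiniteDimensional ℂ V] {ρ : Representation ℂ G V}
    (h : ρ.IsIrreducible) (hρ : Function.Injective ρ) (hdim : finrank ℂ V = p) :
    ∃ T : Subgroup G, IsMulCommutative T ∧ T.index ∣ p := by
  by_cases hcomm : Subgroup.center G = ⊤
  · refine ⟨Subgroup.center G, inferInstance, ?_⟩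
    rw [hcomm, Subgroup.index_top]
    exact one_dvd p
  obtain ⟨a, ha2, ha1⟩ : ∃ a ∈ Subgroup.upperCentralSeries G 2, a ∉ Subgroup.center G := by
    by_contra! hcon
    apply hcomm
    have h12 : Subgroup.upperCentralSeries G 1 = Subgroup.upperCentralSeries G 2 :=
      le_antisymm (Subgroup.upperCentralSeries_mono G one_le_two)
        (by rw [Subgroup.upperCentralSeries_one]; exact hcon)
    rw [← Subgroup.upperCentralSeries_one]
    exact Subgroup.upperCentralSeries.eq_top (by norm_num) h12
  have ha : ∀ g, g * a * g⁻¹ * a⁻¹ ∈ Subgroup.center G := by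
    intro g
    have h1 := Subgroup.mem_upperCentralSeries_succ_iff.1 ha2 g
    rw [Subgroup.upperCentralSeries_one] at h1
    have := inv_mem h1
    rwa [commutatorElement_inv] at this
  -- The subgroup is the centralizer of `a`. It is abelian because `ρ a` will turn out to have `p`
  -- distinct eigenvalues, so everything commuting with it is diagonal in one basis.
  refine ⟨(commutatorHomOfSecondCenter a ha).ker, ?_, ?_⟩
  swap
  · rw [Subgroup.index_ker, ← hZ]
    exact Subgroup.card_subgroup_dvd_card _
  obtain ⟨g, hg⟩ : ∃ g, g * a ≠ a * g := by
    by_contra! hcon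
    exact ha1 (Subgroup.mem_center_iff.2 hcon)
  set z := g * a * g⁻¹ * a⁻¹ with hz
  have hz1 : z ≠ 1 := fun e => hg (by rwa [hz, mul_inv_eq_one, mul_inv_eq_iff_eq_mul] at e)
  obtain ⟨ω, hω⟩ := h.exists_smul_of_commute (ρ z) (fun x => by
    rw [commute_iff_eq, ← map_mul, ← map_mul, Subgroup.mem_center_iff.1 (ha g) x])
  have := h.nontrivial_space
  obtain ⟨μ, hμ⟩ := Module.End.exists_eigenvalue (ρ a)
  obtain ⟨v, hv⟩ := hμ.exists_hasEigenvector
  have hωp : ω ^ p = 1 := by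
    have h1 : z ^ p = 1 := by
      have := pow_card_eq_one' (G := Subgroup.center G) (x := ⟨z, ha g⟩)
      rw [hZ] at this
      exact congrArg Subtype.val this
    have h2 : ∀ k : ℕ, ρ (z ^ k) v = ω ^ k • v := by
      intro k
      induction k with
      | zero => simp
      | succ k ih => rw [pow_succ', map_mul, Module.End.mul_apply, ih, hω, smul_smul, pow_succ']
    have h3 := h2 p
    rw [h1, map_one, Module.End.one_apply] at h3
    exact (smul_left_injective ℂ hv.2 (by simpa using h3)).symm
  have hω1 : ω ≠ 1 := by
    intro e
    apply hz1
    apply hρ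
    ext w
    rw [hω, e, one_smul, map_one, Module.End.one_apply]
  have hprim : IsPrimitiveRoot ω⁻¹ p := by
    have := Fact.mk hp
    have h1 := orderOf_eq_prime hωp hω1
    exact (h1 ▸ IsPrimitiveRoot.orderOf ω).inv
  have hinj : ∀ x : G, Function.Injective (ρ x) := fun x => by
    refine Function.LeftInverse.injective (g := ρ x⁻¹) fun w => ?_
    rw [← Module.End.mul_apply, ← map_mul, inv_mul_cancel, map_one, Module.End.one_apply]
  have hμ0 : μ ≠ 0 := by
    rintro rfl
    apply hv.2
    apply hinj a
    rw [hv.apply_eq_smul, zero_smul, map_zero]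
  have hω0 : ω ≠ 0 := by
    rintro rfl
    rw [zero_pow hp.ne_zero] at hωp
    exact zero_ne_one hωp
  -- The central commutator `z` acts by a primitive `p`-th root of unity `ω`, so `ρ g` multiplies
  -- eigenvalues of `ρ a` by `ω⁻¹`.
  have hshift : ∀ w, ρ a (ρ g w) = ω⁻¹ • ρ g (ρ a w) := by
    intro w
    have h1 : g * a = z * (a * g) := by rw [hz]; group
    have h2 : ρ g (ρ a w) = ω • ρ a (ρ g w) := by
      rw [← Module.End.mul_apply, ← map_mul, h1, map_mul ρ z, Module.End.mul_apply, hω, map_mul,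
        Module.End.mul_apply]
    rw [h2, inv_smul_smul₀ hω0]
  have heig : ∀ i : ℕ, ρ a (ρ (g ^ i) v) = (μ * ω⁻¹ ^ i) • ρ (g ^ i) v := by
    intro i
    induction i with
    | zero => simpa using hv.apply_eq_smul
    | succ i ih =>
      rw [pow_succ', map_mul, Module.End.mul_apply, hshift, ih, map_smul, smul_smul]
      congr 1
      ring
  let m : Fin p → ℂ := fun i => μ * ω⁻¹ ^ (i : ℕ)
  have hm : Function.Injective m := by
    intro i j hij
    exact Fin.ext (hprim.pow_inj i.2 j.2 (mul_left_cancel₀ hμ0 hij))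
  have hli : LinearIndependent ℂ fun i : Fin p => ρ (g ^ (i : ℕ)) v :=
    Module.End.eigenvectors_linearIndependent' (ρ a) m hm _ fun i =>
      ⟨Module.End.mem_eigenspace_iff.2 (heig i), fun e => hv.2 (hinj (g ^ (i : ℕ)) (by
        rw [e, map_zero]))⟩
  have : Nonempty (Fin p) := ⟨⟨0, hp.pos⟩⟩
  let b := basisOfLinearIndependentOfCardEqFinrank hli (by rw [Fintype.card_fin, hdim])
  have hb : ∀ i, ρ a (b i) = m i • b i := by
    intro i
    rw [coe_basisOfLinearIndependentOfCardEqFinrank]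
    exact heig i
  refine ⟨⟨fun s t => Subtype.ext (hρ ?_)⟩⟩
  have key : ∀ s ∈ (commutatorHomOfSecondCenter a ha).ker, Commute (ρ a) (ρ s) := by
    intro s hs
    rw [commute_iff_eq, ← map_mul, ← map_mul, mem_ker_commutatorHomOfSecondCenter.1 hs]
  have := b.commute_of_commute_of_injective_eigenvalues hm hb (key s s.2) (key t t.2)
  simpa using this.eq

/-! ### Structure of groups of maximal class -/

section MaximalClass

variable {G : Type*} [Group G]

/-- A nontrivial normal subgroup of a nilpotent group meets the center nontrivially. -/
theorem Subgroup.inf_center_ne_bot [Group.IsNilpotent G] (N : Subgroup G) [N.Normal] (hN : N ≠ ⊥) :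
    N ⊓ Subgroup.center G ≠ ⊥ := by
  classical
  have hex : ∃ k, N ⊓ Subgroup.upperCentralSeries G k ≠ ⊥ := by
    obtain ⟨k, hk⟩ := Group.IsNilpotent.nilpotent G
    exact ⟨k, by rwa [hk, inf_top_eq]⟩
  obtain ⟨j, hj⟩ : ∃ j, Nat.find hex = j + 1 := by
    refine Nat.exists_eq_succ_of_ne_zero fun h0 => ?_
    have := Nat.find_spec hex
    rw [h0, Subgroup.upperCentralSeries_zero, inf_bot_eq] at this
    exact this rfl
  have h1 := Nat.find_spec hex
  have h2 := Nat.find_min hex (m := j) (by omega)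
  rw [hj] at h1
  rw [not_not] at h2
  obtain ⟨⟨x, hx⟩, hx1⟩ := Subgroup.ne_bot_iff_exists_ne_one.1 h1
  refine Subgroup.ne_bot_iff_exists_ne_one.2
    ⟨⟨x, hx.1, Subgroup.mem_center_iff.2 fun y => ?_⟩,
      fun e => hx1 (Subtype.ext (show x = 1 from congrArg Subtype.val e))⟩
  have h3 : ⁅x, y⁆ ∈ N ⊓ Subgroup.upperCentralSeries G j := by
    refine ⟨?_, Subgroup.mem_upperCentralSeries_succ_iff.1 hx.2 y⟩
    rw [commutatorElement_def, mul_assoc, mul_assoc]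
    refine N.mul_mem hx.1 ?_
    rw [← mul_assoc]
    exact ‹N.Normal›.conj_mem _ (N.inv_mem hx.1) y
  rw [h2, Subgroup.mem_bot, commutatorElement_eq_one_iff_mul_comm] at h3
  exact h3.symm

theorem Subgroup.center_le_of_prime_card [Group.IsNilpotent G]
    (hZ : (Nat.card (Subgroup.center G)).Prime) (N : Subgroup G) [N.Normal] (hN : N ≠ ⊥) :
    Subgroup.center G ≤ N := by
  have := Fact.mk hZ
  rcases ((N ⊓ Subgroup.center G).subgroupOf (Subgroup.center G)).eq_bot_or_eq_top_of_prime_card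
    with h | h
  · rw [Subgroup.subgroupOf_eq_bot, disjoint_iff, inf_assoc, inf_idem] at h
    exact (N.inf_center_ne_bot hN h).elim
  · exact (Subgroup.subgroupOf_eq_top.1 h).trans inf_le_left

theorem isMulCommutative_of_card_quotient_center_dvd {p : ℕ} (hp : p.Prime)
    (h : Nat.card (G ⧸ Subgroup.center G) ∣ p) : IsMulCommutative G := by
  have := Fact.mk hp
  have : IsCyclic (G ⧸ Subgroup.center G) := isCyclic_of_card_dvd_prime h
  exact isMulCommutative_of_isCyclic_quotient_center_self G

theorem exists_card_center_eq_prime_pow {p m : ℕ} (hp : p.Prime) (hG : Nat.card G = p ^ m)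
    (hm : 0 < m) : ∃ k j, 0 < k ∧ k + j = m ∧ Nat.card (Subgroup.center G) = p ^ k ∧
      Nat.card (G ⧸ Subgroup.center G) = p ^ j := by
  have := Fact.mk hp
  obtain ⟨k, hk0, hk⟩ := IsPGroup.card_center_eq_prime_pow hG hm
  have hkm : k ≤ m := (Nat.pow_dvd_pow_iff_le_right hp.one_lt).1 (by
    rw [← hk, ← hG]; exact Subgroup.card_subgroup_dvd_card _)
  obtain ⟨j, rfl⟩ := Nat.exists_eq_add_of_le hkm
  refine ⟨k, j, hk0, rfl, hk, ?_⟩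
  have hcard := (Subgroup.center G).card_mul_index
  rw [hk, hG, pow_add, Nat.mul_right_inj (pow_ne_zero k hp.ne_zero)] at hcard
  exact hcard

/-- A group of order `p ^ m`, `m ≥ 2`, has nilpotency class at most `m - 1`. -/
theorem nilpotencyClass_le_of_card_eq_prime_pow {p : ℕ} (hp : p.Prime) :
    ∀ (m : ℕ) (G : Type*) [Group G], Nat.card G = p ^ m → 2 ≤ m →
      Group.nilpotencyClass G ≤ m - 1 := by
  intro m
  have := Fact.mk hp
  induction m using Nat.strong_induction_on with
  | _ m ih =>
    intro G _ hG hm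
    have : Finite G := Nat.finite_of_card_ne_zero (hG ▸ pow_ne_zero m hp.ne_zero)
    have : Group.IsNilpotent G := (IsPGroup.of_card hG).isNilpotent
    by_cases hm2 : m = 2
    · subst hm2
      exact Group.IsNilpotent.nilpotencyClass_le_one_iff.2
        (IsPGroup.isMulCommutative_of_card_eq_prime_sq hG)
    obtain ⟨k, j, hk0, hkj, -, hQ⟩ := exists_card_center_eq_prime_pow hp hG (by omega)
    have hc := Group.nilpotencyClass_quotient_center (G := G)
    by_cases h2 : 2 ≤ j
    · have := ih j (by omega) _ hQ h2
      omega
    · have := Group.IsNilpotent.nilpotencyClass_le_one_iff.2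
        (isMulCommutative_of_card_quotient_center_dvd hp
          (hQ ▸ (pow_dvd_pow p (by omega : j ≤ 1)).trans (by rw [pow_one])))
      omega

variable {p n : ℕ}

theorem IsMaximalClass.isMulCommutative (hp : p.Prime) (hG : IsMaximalClass p 2 G) :
    IsMulCommutative G :=
  have := Fact.mk hp
  IsPGroup.isMulCommutative_of_card_eq_prime_sq hG.card_eq

theorem IsMaximalClass.not_isMulCommutative (hp : p.Prime) (hG : IsMaximalClass p n G)
    (hn : 3 ≤ n) : ¬ IsMulCommutative G := by
  intro h
  have := Fact.mk hp
  have : Finite G := Nat.finite_of_card_ne_zero (hG.card_eq ▸ pow_ne_zero n hp.ne_zero)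
  have : Group.IsNilpotent G := (IsPGroup.of_card hG.card_eq).isNilpotent
  have := Group.IsNilpotent.nilpotencyClass_le_one_iff.2 h
  have := hG.class_eq
  omega

/-- The central quotient has class `n - 2`. A center larger than `p` would leave a quotient of order
at most `p ^ (n - 2)`, whose class is too small. -/
theorem IsMaximalClass.card_center (hp : p.Prime) (hG : IsMaximalClass p n G) (hn : 3 ≤ n) :
    Nat.card (Subgroup.center G) = p := by
  obtain ⟨k, j, hk0, hkj, hk, hQ⟩ := exists_card_center_eq_prime_pow hp hG.card_eq (by omega)
  have hj : 2 ≤ j := by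
    by_contra hj
    exact hG.not_isMulCommutative hp hn (isMulCommutative_of_card_quotient_center_dvd hp
      (hQ ▸ (pow_dvd_pow p (by omega : j ≤ 1)).trans (by rw [pow_one])))
  have h1 := nilpotencyClass_le_of_card_eq_prime_pow hp j _ hQ hj
  rw [Group.nilpotencyClass_quotient_center, hG.class_eq] at h1
  rw [hk, show k = 1 by omega, pow_one]

theorem IsMaximalClass.quotient_center (hp : p.Prime) (hG : IsMaximalClass p n G) (hn : 3 ≤ n) :
    IsMaximalClass p (n - 1) (G ⧸ Subgroup.center G) where
  two_le := by omega
  card_eq := by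
    have h := (Subgroup.center G).card_mul_index
    rw [hG.card_center hp hn, hG.card_eq, ← Nat.sub_add_cancel (show 1 ≤ n by omega), pow_succ',
      Nat.mul_right_inj hp.ne_zero] at h
    exact h
  class_eq := by rw [Group.nilpotencyClass_quotient_center, hG.class_eq]

/-- The derived subgroup of a group of maximal class has index dividing `p ^ 2`. -/
theorem IsMaximalClass.index_commutator_dvd (hp : p.Prime) :
    ∀ (n : ℕ) (G : Type*) [Group G], IsMaximalClass p n G → (commutator G).index ∣ p ^ 2 := by
  intro n
  have := Fact.mk hp
  induction n with
  | zero => intro G _ hG; exact absurd hG.two_le (by norm_num)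
  | succ n ih =>
    intro G _ hG
    by_cases hn : 3 ≤ n + 1
    · have : Finite G := Nat.finite_of_card_ne_zero (hG.card_eq ▸ pow_ne_zero _ hp.ne_zero)
      have : Group.IsNilpotent G := (IsPGroup.of_card hG.card_eq).isNilpotent
      have h1 := ih _ (hG.quotient_center hp hn)
      have hsurj := QuotientGroup.mk'_surjective (Subgroup.center G)
      -- Since `Z(G) ≤ G'`, the index of the derived subgroup is unchanged in `G ⧸ Z(G)`.
      have h2 : (commutator G).map (QuotientGroup.mk' (Subgroup.center G)) =
          commutator (G ⧸ Subgroup.center G) := by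
        rw [commutator_def, commutator_def, Subgroup.map_commutator,
          Subgroup.map_top_of_surjective _ hsurj]
      rw [← h2, Subgroup.index_map_eq _ hsurj] at h1
      · exact h1
      · rw [QuotientGroup.ker_mk']
        refine Subgroup.center_le_of_prime_card (by rwa [hG.card_center hp hn]) _ fun e => ?_
        exact hG.not_isMulCommutative hp hn ((commutator_eq_bot_iff G).1 e)
    · have : n + 1 = 2 := by have := hG.two_le; omega
      rw [← this, ← hG.card_eq]
      exact Subgroup.index_dvd_card _

end MaximalClass

/-! ### Codegrees -/

section Codegree

variable {G : Type*} [Group G]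

theorem codegree_mem_cod {V : Type} [AddCommGroup V] [Module ℂ V] [FiniteDimensional ℂ V]
    {ρ : Representation ℂ G V} (h : ρ.IsIrreducible) : codegree ρ ∈ cod G :=
  ⟨V, inferInstance, inferInstance, inferInstance, ρ, h, rfl⟩

theorem cod_quotient_subset (N : Subgroup G) [N.Normal] : cod (G ⧸ N) ⊆ cod G := by
  rintro q ⟨V, _, _, _, ρ, hρ, rfl⟩
  have hsurj := QuotientGroup.mk'_surjective N
  refine ⟨V, _, _, inferInstance, ρ.comp (QuotientGroup.mk' N),
    (Representation.IsIrreducible.comp_iff hsurj).2 hρ, ?_⟩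
  have : MonoidHom.ker (ρ.comp (QuotientGroup.mk' N)) =
      (MonoidHom.ker ρ).comap (QuotientGroup.mk' N) := rfl
  rw [codegree, codegree, this, Subgroup.index_comap_of_surjective _ hsurj]

theorem one_mem_cod : (1 : ℚ) ∈ cod G := by
  let ρ : Representation ℂ G ℂ := 1
  have hk : MonoidHom.ker ρ = ⊤ := MonoidHom.ker_one
  have h : ρ.IsIrreducible := Representation.isIrreducible_of_finrank_eq_one (finrank_self ℂ)
  have := codegree_mem_cod h
  rwa [codegree, hk, Subgroup.index_top, finrank_self, Nat.cast_one, div_one] at this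

variable {p n : ℕ}

/-- The codegrees of a noncyclic group of order `p ^ n` are among `1, p, …, p ^ (n - 1)`. -/
theorem exists_eq_pow_of_mem_cod (hp : p.Prime) (hG : Nat.card G = p ^ n) (hcyc : ¬ IsCyclic G)
    {q : ℚ} (hq : q ∈ cod G) : ∃ i ≤ n - 1, q = (p : ℚ) ^ i := by
  have : Finite G := Nat.finite_of_card_ne_zero (hG ▸ pow_ne_zero n hp.ne_zero)
  obtain ⟨V, _, _, _, ρ, hρ, rfl⟩ := hq
  obtain ⟨a, han, ha⟩ := (Nat.dvd_prime_pow hp).1 (hG ▸ (MonoidHom.ker ρ).index_dvd_card)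
  obtain ⟨b, hba, hb⟩ := (Nat.dvd_prime_pow hp).1 (ha ▸ hρ.finrank_dvd_index_ker)
  have hp0 : (p : ℚ) ≠ 0 := by exact_mod_cast hp.ne_zero
  refine ⟨a - b, ?_, ?_⟩
  · by_contra hcon
    obtain rfl : b = 0 := by omega
    obtain rfl : a = n := by omega
    refine hcyc (Representation.isCyclic_of_finrank_eq_one (ρ := ρ) ?_ (by rw [hb, pow_zero]))
    have h1 := (MonoidHom.ker ρ).card_mul_index
    rw [ha, hG, Nat.mul_eq_right (pow_ne_zero _ hp.ne_zero), Subgroup.card_eq_one] at h1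
    refine (injective_iff_map_eq_one _).2 fun x hx => ?_
    rwa [← MonoidHom.mem_ker, h1, Subgroup.mem_bot] at hx
  · rw [codegree, ha, hb, pow_sub₀ _ hp0 hba, Nat.cast_pow, Nat.cast_pow, div_eq_mul_inv]

theorem Representation.IsIrreducible.pow_sub_mem_cod (hp : p.Prime) (hG : Nat.card G = p ^ n)
    {V : Type} [AddCommGroup V] [Module ℂ V] [FiniteDimensional ℂ V]
    {ρ : Representation ℂ G V} (h : ρ.IsIrreducible) (hρ : Function.Injective ρ) {b : ℕ}
    (hbn : b ≤ n) (hb : finrank ℂ V = p ^ b) : (p : ℚ) ^ (n - b) ∈ cod G := by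
  have hp0 : (p : ℚ) ≠ 0 := by exact_mod_cast hp.ne_zero
  have hk : MonoidHom.ker ρ = ⊥ := by
    refine (Subgroup.eq_bot_iff_forall _).2 fun x hx => hρ ?_
    rw [map_one]
    exact hx
  have := codegree_mem_cod h
  rwa [codegree, hk, Subgroup.index_bot, hG, hb, Nat.cast_pow, Nat.cast_pow, div_eq_mul_inv,
    ← pow_sub₀ _ hp0 hbn] at this

/-- A finite nilpotent group with center of prime order has a faithful irreducible complex
representation. -/
theorem exists_isIrreducible_injective [Finite G] [Group.IsNilpotent G]
    (hZ : (Nat.card (Subgroup.center G)).Prime) :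
    ∃ (V : Type) (_ : AddCommGroup V) (_ : Module ℂ V) (_ : FiniteDimensional ℂ V)
      (ρ : Representation ℂ G V), ρ.IsIrreducible ∧ Function.Injective ρ := by
  have : Nontrivial (Subgroup.center G) := Finite.one_lt_card_iff_nontrivial.1 hZ.one_lt
  obtain ⟨z, hz⟩ := exists_ne (1 : Subgroup.center G)
  obtain ⟨V, _, _, _, ρ, hρ, hρz⟩ := Representation.exists_isIrreducible_apply_ne_one
    (z := (z : G)) (fun e => hz (Subtype.ext e))
  refine ⟨V, _, _, inferInstance, ρ, hρ, ?_⟩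
  have hk : MonoidHom.ker ρ = ⊥ := by
    by_contra hne
    exact hρz (Subgroup.center_le_of_prime_card hZ _ hne z.2)
  refine (injective_iff_map_eq_one _).2 fun x hx => ?_
  rwa [← MonoidHom.mem_ker, hk, Subgroup.mem_bot] at hx

/-- The codegrees `1, p, …, p ^ (n - 2)` occur in every noncyclic group of maximal class with an
abelian subgroup of index dividing `p ^ 2`, and `p ^ (n - 1)` occurs as well if there is an abelian
subgroup of index dividing `p`. -/
theorem IsMaximalClass.pow_mem_cod (hp : p.Prime) :
    ∀ (n : ℕ) (G : Type*) [Group G], IsMaximalClass p n G → ¬ IsCyclic G →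
      (∃ A : Subgroup G, IsMulCommutative A ∧ A.index ∣ p ^ 2) →
      (∀ i ≤ n - 2, (p : ℚ) ^ i ∈ cod G) ∧
        ((∃ B : Subgroup G, IsMulCommutative B ∧ B.index ∣ p) → (p : ℚ) ^ (n - 1) ∈ cod G) := by
  intro n
  have := Fact.mk hp
  induction n with
  | zero => intro G _ hG; exact absurd hG.two_le (by norm_num)
  | succ n ih =>
    intro G _ hG hcyc hA
    have hfin : Finite G := Nat.finite_of_card_ne_zero (hG.card_eq ▸ pow_ne_zero _ hp.ne_zero)
    have hnil : Group.IsNilpotent G := (IsPGroup.of_card hG.card_eq).isNilpotent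
    by_cases hn : n + 1 = 2
    · obtain rfl : n = 1 := by omega
      refine ⟨fun i hi => ?_, fun _ => ?_⟩
      · obtain rfl : i = 0 := by omega
        rw [pow_zero]
        exact one_mem_cod
      -- In order `p ^ 2`, a nontrivial linear character has codegree other than `1`, and
      -- noncyclicity leaves only `p`.
      · have := hG.isMulCommutative hp
        have : Nontrivial G := by
          rw [← Finite.one_lt_card_iff_nontrivial, hG.card_eq]
          exact Nat.one_lt_pow (by norm_num) hp.one_lt
        obtain ⟨z, hz⟩ := exists_ne (1 : G)
        obtain ⟨V, _, _, _, ρ, hρ, hρz⟩ := Representation.exists_isIrreducible_apply_ne_one hz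
        have hmem := codegree_mem_cod hρ
        obtain ⟨i, hi, h⟩ := exists_eq_pow_of_mem_cod hp hG.card_eq hcyc hmem
        have hi' : i ≠ 0 := by
          rintro rfl
          have hd : finrank ℂ V = 1 := hρ.finrank_eq_one_of_isMulCommutative
          rw [codegree, hd, Nat.cast_one, div_one, pow_zero, Nat.cast_eq_one,
            Subgroup.index_eq_one] at h
          have : z ∈ MonoidHom.ker ρ := h ▸ Subgroup.mem_top z
          exact hρz this
        obtain rfl : i = 1 := by omega
        rwa [h] at hmem
    · have hn3 : 3 ≤ n + 1 := by have := hG.two_le; omega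
      have hZ := hG.card_center hp hn3
      have hQ := hG.quotient_center hp hn3
      have hmap : ∀ {m : ℕ}, (∃ A : Subgroup G, IsMulCommutative A ∧ A.index ∣ m) →
          ∃ A : Subgroup (G ⧸ Subgroup.center G), IsMulCommutative A ∧ A.index ∣ m := by
        rintro m ⟨A, hA, hAm⟩
        exact ⟨A.map (QuotientGroup.mk' _), inferInstance,
          (A.index_map_dvd (QuotientGroup.mk'_surjective _)).trans hAm⟩
      have hQcyc : ¬ IsCyclic (G ⧸ Subgroup.center G) := fun _ =>
        hG.not_isMulCommutative hp hn3 (isMulCommutative_of_isCyclic_quotient_center_self G)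
      obtain ⟨ih1, ih2⟩ := ih _ hQ hQcyc (hmap hA)
      obtain ⟨V, _, _, _, ρ, hρ, hinj⟩ := exists_isIrreducible_injective (hZ.symm ▸ hp)
      obtain ⟨b, hbn, hb⟩ := (Nat.dvd_prime_pow hp).1 (hG.card_eq ▸ hρ.finrank_dvd_card)
      have hb0 : b ≠ 0 := by
        rintro rfl
        exact hcyc (Representation.isCyclic_of_finrank_eq_one hinj (by rw [hb, pow_zero]))
      have hle : ∀ k, (∃ A : Subgroup G, IsMulCommutative A ∧ A.index ∣ p ^ k) → b ≤ k := by
        rintro k ⟨A, hA, hAk⟩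
        refine (Nat.pow_le_pow_iff_right hp.one_lt).1 ?_
        rw [← hb]
        exact (hρ.finrank_le_index A).trans (Nat.le_of_dvd (pow_pos hp.pos k) hAk)
      have hmem := hρ.pow_sub_mem_cod hp hG.card_eq hinj hbn hb
      constructor
      · intro i hi
        by_cases hi' : i ≤ n - 2
        · exact cod_quotient_subset _ (ih1 i hi')
        -- The order is `p ^ (n + 1)` here, so `n - 1` is the one exponent not covered by `ih1`. For
        -- `b = 1` it is the top exponent of the quotient, supplied by `ih2`; for `b = 2` it is `(n
        -- + 1) - b`.
        obtain rfl : i = n - 1 := by omega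
        have hb2 := hle 2 hA
        by_cases hb1 : b = 1
        · exact cod_quotient_subset _ (ih2 (hmap (hρ.exists_isMulCommutative_index_dvd hp hZ hinj
            (by rw [hb, hb1, pow_one]))))
        · obtain rfl : b = 2 := by omega
          exact hmem
      · intro hB
        have := hle 1 (by rwa [pow_one])
        obtain rfl : b = 1 := by omega
        exact hmem

end Codegree

theorem IsMetabelian.isMulCommutative_commutator {G : Type*} [Group G] (h : IsMetabelian G) :
    IsMulCommutative (commutator G) := by
  rw [IsMetabelian, derivedSeries_succ, derivedSeries_one] at h
  exact (Subgroup.le_centralizer_iff_isMulCommutative).1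
    (Subgroup.commutator_eq_bot_iff_le_centralizer.1 h)

theorem corollaryC (p n : ℕ) (hp : p.Prime) (G : Type*) [Group G] [Finite G]
    (hG : IsMaximalClass p n G) (hcyc : ¬ IsCyclic G) (hmet : IsMetabelian G) :
    ∃ c : ℕ, (c = n - 1 ∨ c = n - 2) ∧ cod G = {q : ℚ | ∃ i : ℕ, i ≤ c ∧ q = (p : ℚ) ^ i} := by
  have hlow := (hG.pow_mem_cod hp n G hcyc ⟨commutator G, hmet.isMulCommutative_commutator,
    hG.index_commutator_dvd hp n G⟩).1
  by_cases htop : (p : ℚ) ^ (n - 1) ∈ cod G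
  · refine ⟨n - 1, Or.inl rfl, Set.Subset.antisymm
      (fun q hq => exists_eq_pow_of_mem_cod hp hG.card_eq hcyc hq) ?_⟩
    rintro q ⟨i, hi, rfl⟩
    rcases hi.eq_or_lt with rfl | hi
    · exact htop
    · exact hlow i (by omega)
  · refine ⟨n - 2, Or.inr rfl, Set.Subset.antisymm (fun q hq => ?_) ?_⟩
    · obtain ⟨i, hi, rfl⟩ := exists_eq_pow_of_mem_cod hp hG.card_eq hcyc hq
      refine ⟨i, ?_, rfl⟩
      have : i ≠ n - 1 := by rintro rfl; exact htop hq
      omega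
    · rintro q ⟨i, hi, rfl⟩
      exact hlow i hi
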